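/- Let $n\ge 1$. Equip $\mathbb{R}^{2n}=\mathbb{C}^n$, $z_i=x_i+\sqrt{-1}\,y_i$, with $\omega_{\rm std}=\sum_i dx_i\wedge dy_i$, and $T^*\mathbb{T}^n=\mathbb{T}^n\times\mathbb{R}^n$, $\mathbb{T}^n=(\mathbb{R}/\mathbb{Z})^n$, with $\omega_{\rm can}=d\big(\sum_i p_i\,dq_i\big)$. Put $\mu(z)=\pi(|z_1|^2,\dots,|z_n|^2)$ and $X_A:=\mu^{-1}(A)\subset\mathbb{C}^n$ for $A\subset\mathbb{R}^n_{\ge 0}$. Let $\Omega\subset\mathbb{R}^n_{\ge 0}$ be compact and the closure of a non-empty relatively open subset of $\mathbb{R}^n_{\ge 0}$, and suppose that the toric domain $X_\Omega$ is monotone: at every point of $\partial\Omega\cap\mathbb{R}^n_{>0}$ every outward normal vector of $\Omega$ has only non-negative entries. (Here $v$ is an outward normal vector of $\Omega$ at $p$ if $\langle v,w\rangle\le 0$ for every $w$ in the contingent tangent cone of $\Omega$ at $p$; where $\partial\Omega$ is a $C^1$ hypersurface bounding $\Omega$, these are the non-negative multiples of the usual outward unit normal.) Let $\mathrm{int}(\Omega)\subset\mathbb{R}^n_{>0}$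 be the interior of $\Omega$ in $\mathbb{R}^n$. Then for every $0<\epsilon<1$ there are symplectic embeddings $$\big((1-\epsilon)X_\Omega,\omega_{\rm std}\big)\hookrightarrow\big(\mathbb{T}^n\times\mathrm{int}(\Omega),\omega_{\rm can}\big)\hookrightarrow\big(X_\Omega,\omega_{\rm std}\big),$$ where $(1-\epsilon)X_\Omega=\{(1-\epsilon)z : z\in X_\Omega\}$, and a symplectic embedding of a set that is not open is a smooth symplectic embedding of an open neighbourhood of it. Moreover, $(\mathbb{T}^n\times\mathrm{int}(\Omega),\omega_{\rm can})$ is symplectomorphic to $(X_{\mathrm{int}(\Omega)},\omega_{\rm std})$. -/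

import Mathlib

open Set
open scoped ContDiff Pointwise

namespace ToricDomain

/-! ### The two symplectic manifolds -/

/-- The standard symplectic form `ω_std = ∑ dxᵢ ∧ dyᵢ` on `ℝ²ⁿ = ℂⁿ`, `zᵢ = xᵢ + √-1 yᵢ`
(a constant form, evaluated on the tangent vectors `u`, `v`). -/
def omegaStd {n : ℕ} (u v : Fin n → ℂ) : ℝ :=
  ∑ i, ((u i).re * (v i).im - (u i).im * (v i).re)

/-- The cotangent bundle `T^*𝕋ⁿ = 𝕋ⁿ × ℝⁿ` of the torus `𝕋ⁿ = (ℝ/ℤ)ⁿ`, with points `(q, p)`. -/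
abbrev CotangentTorus (n : ℕ) : Type :=
  (Fin n → UnitAddCircle) × (Fin n → ℝ)

/-- The universal covering `T^*ℝⁿ → T^*𝕋ⁿ`, `(q, p) ↦ (q mod ℤⁿ, p)`. It is a local diffeomorphism,
and its local inverses are the standard coordinate charts of `T^*𝕋ⁿ`. -/
def torusCover (n : ℕ) (x : (Fin n → ℝ) × (Fin n → ℝ)) : CotangentTorus n :=
  (fun i => (x.1 i : UnitAddCircle), x.2)

/-- The canonical symplectic form `ω_can = d(∑ pᵢ dqᵢ) = ∑ dpᵢ ∧ dqᵢ` of `T^*𝕋ⁿ`, written in the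
coordinates `(q, p)`; it is a constant form, invariant under the integer translations of `q`. -/
def omegaCan {n : ℕ} (u v : (Fin n → ℝ) × (Fin n → ℝ)) : ℝ :=
  ∑ i, (u.2 i * v.1 i - u.1 i * v.2 i)

/-! ### Symplectic maps -/

section Symplectic

variable {V V' M M' : Type*}
  [NormedAddCommGroup V] [NormedSpace ℝ V] [NormedAddCommGroup V'] [NormedSpace ℝ V']

/-- Let `M` be a manifold whose smooth structure is given by a local diffeomorphism `c` from the
vector space `V` onto `M`, with a symplectic form that reads as the constant form `η` in these
coordinates, and similarly for `M'`, `c'`, `V'`, `η'`. The map `f : M → M'` is smooth and symplectic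
on the open set `U` if near every coordinate vector `x` of every point of `U` it is represented
in coordinates by a smooth map `g` with `g^* η' = η`. -/
def IsSymplecticMapOn (c : V → M) (η : V → V → ℝ) (c' : V' → M') (η' : V' → V' → ℝ)
    (f : M → M') (U : Set M) : Prop :=
  ∀ x : V, c x ∈ U → ∃ W : Set V, IsOpen W ∧ x ∈ W ∧ ∃ g : V → V', ContDiffOn ℝ ∞ g W ∧
    (∀ y ∈ W, c' (g y) = f (c y)) ∧
    ∀ y ∈ W, ∀ a b : V, η' (fderiv ℝ g y a) (fderiv ℝ g y b) = η a b

/-- Existence of a symplectic embedding `S ↪ S'`. As usual for a set `S` that need not be open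
(such as a domain with its boundary), the embedding is smooth and symplectic on an open
neighbourhood `U` of `S`; for open `S` one can take `U = S`. The nondegeneracy of `η` makes `f`
an immersion on `U`, so that a topological embedding is an embedding of manifolds. -/
def SymplecticallyEmbeds [TopologicalSpace M] [TopologicalSpace M']
    (c : V → M) (η : V → V → ℝ) (c' : V' → M') (η' : V' → V' → ℝ)
    (S : Set M) (S' : Set M') : Prop :=
  ∃ (U : Set M) (f : M → M'), IsOpen U ∧ S ⊆ U ∧ IsSymplecticMapOn c η c' η' f U ∧
    Topology.IsEmbedding (fun x : U => f x) ∧ MapsTo f S S'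

/-- The open sets `S` and `S'` are symplectomorphic: there are mutually inverse smooth symplectic
maps between them. -/
def Symplectomorphic [TopologicalSpace M] [TopologicalSpace M']
    (c : V → M) (η : V → V → ℝ) (c' : V' → M') (η' : V' → V' → ℝ)
    (S : Set M) (S' : Set M') : Prop :=
  IsOpen S ∧ IsOpen S' ∧ ∃ (f : M → M') (g : M' → M),
    MapsTo f S S' ∧ MapsTo g S' S ∧ InvOn g f S S' ∧
    IsSymplecticMapOn c η c' η' f S ∧ IsSymplecticMapOn c' η' c η g S'

end Symplectic

/-! ### Toric domains -/

/-- The moment map `μ(z) = π (|z₁|², …, |zₙ|²)`. -/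
noncomputable def moment {n : ℕ} (z : Fin n → ℂ) : Fin n → ℝ :=
  fun i => Real.pi * ‖z i‖ ^ 2

/-- The set `X_Ω = μ⁻¹(Ω) ⊆ ℂⁿ`. -/
def toricSet {n : ℕ} (Ω : Set (Fin n → ℝ)) : Set (Fin n → ℂ) :=
  {z | moment z ∈ Ω}

/-- `Ω` is the moment image of a (compact) toric domain: it is compact, and it is the closure of
a non-empty relatively open subset of the closed orthant `{p | 0 ≤ p} = ℝⁿ_{≥ 0}`. -/
def IsMomentDomain {n : ℕ} (Ω : Set (Fin n → ℝ)) : Prop :=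
  IsCompact Ω ∧ ∃ U : Set (Fin n → ℝ), IsOpen U ∧ (U ∩ {p | 0 ≤ p}).Nonempty ∧
    Ω = closure (U ∩ {p | 0 ≤ p})

/-- `v` is an outward normal vector of `Ω` at `p`: it makes no acute angle with a vector tangent to
`Ω` at `p`, that is, it lies in the polar of the tangent (contingent) cone. Where `∂Ω` is a
hypersurface of class `C¹` bounding `Ω`, these are exactly the non-negative multiples of the usual
outward unit normal; where `Ω` is convex, this is the normal cone of convex geometry. -/
def IsOutwardNormal {n : ℕ} (Ω : Set (Fin n → ℝ)) (p v : Fin n → ℝ) : Prop :=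
  ∀ w ∈ posTangentConeAt Ω p, v ⬝ᵥ w ≤ 0

/-- `X_Ω` is a monotone toric domain: all outward normals at the points of the profile hypersurface
`∂Ω ∩ ℝⁿ_{> 0}` have non-negative entries. -/
def IsMonotoneToric {n : ℕ} (Ω : Set (Fin n → ℝ)) : Prop :=
  IsMomentDomain Ω ∧ ∀ p ∈ frontier Ω, (∀ i, 0 < p i) →
    ∀ v, IsOutwardNormal Ω p v → ∀ i, 0 ≤ v i

end ToricDomain

/-! Symplectic polar coordinates `p = π|z|²`, `q = arg z / 2π` satisfy `dx ∧ dy = dp ∧ dq` away from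
the origin. Taken coordinatewise they identify `𝕋ⁿ × P` with `X_P` for every open `P` in the open
positive orthant. With `P = int Ω` this gives the symplectomorphism and, by inclusion, the second
embedding.

The first embedding has to deal with points of `X_Ω` having vanishing coordinates. A disc of radius
`R` is pushed off the ray `(-∞, 0]` by an area-preserving map `slitMap` that increases `|w|²` by an
arbitrarily small amount. On the slit plane polar coordinates have a global branch, so the product
map followed by polar coordinates embeds a polydisc into `T^*𝕋ⁿ`, with momenta positive and at most
`μ(z) + δ` (`exists_polydisc_embedding`). The map may also decrease momenta by an uncontrolled
amount, and this is where monotonicity enters: `Ω` contains every positive point strictly below one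
of its points (`IsMonotoneToric.mem_of_lt`). Compactness supplies a `δ` for which positive vectors
bounded by `(1 - ε)² p + δ` with `p ∈ Ω` stay in `int Ω` (`IsMonotoneToric.exists_margin`). -/

namespace ToricDomain

/-! ### Monotone domains are down-closed -/

section Geometry

variable {n : ℕ} {Ω : Set (Fin n → ℝ)}

/-- A point of `Ω` that minimizes the Euclidean distance to `c` has `c - y` as outward normal. -/
theorem isOutwardNormal_of_minimizer {c y : Fin n → ℝ}
    (hmin : ∀ x ∈ Ω, ∑ i, (c i - y i) ^ 2 ≤ ∑ i, (c i - x i) ^ 2) :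
    IsOutwardNormal Ω y (c - y) := by
  intro w hw
  have hd : HasFDerivAt (fun x : Fin n → ℝ => ∑ i, (c i - x i) ^ 2)
      (∑ i, (2 * (c i - y i)) • (-(ContinuousLinearMap.proj i : (Fin n → ℝ) →L[ℝ] ℝ))) y := by
    refine HasFDerivAt.fun_sum fun i _ => ?_
    have h := ((hasFDerivAt_apply (𝕜 := ℝ) i y).const_sub (c i)).pow 2
    simpa using h
  have hloc : IsLocalMinOn (fun x : Fin n → ℝ => ∑ i, (c i - x i) ^ 2) Ω y :=
    Filter.eventually_of_mem self_mem_nhdsWithin hmin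
  have h := hloc.hasFDerivWithinAt_nonneg hd.hasFDerivWithinAt hw
  simp only [sum_apply, smul_apply,
    neg_apply, ContinuousLinearMap.proj_apply, smul_eq_mul] at h
  have h2 : ∑ i, 2 * (c i - y i) * -w i = -2 * ((c - y) ⬝ᵥ w) := by
    rw [dotProduct, Finset.mul_sum]
    exact Finset.sum_congr rfl fun i _ => by simp only [Pi.sub_apply]; ring
  linarith

/-- A point of `Ω` with a nonzero outward normal is a boundary point. -/
theorem mem_frontier_of_isOutwardNormal {y v : Fin n → ℝ} (hy : y ∈ Ω)
    (hv : IsOutwardNormal Ω y v) (hv0 : v ≠ 0) : y ∈ frontier Ω := by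
  refine ⟨subset_closure hy, fun hint => hv0 ?_⟩
  have hc : Continuous fun t : ℝ => y + t • v := by fun_prop
  -- At an interior point every direction is tangent, in particular `v` itself, so `⟨v, v⟩ ≤ 0`.
  have h := hv v (mem_posTangentConeAt_of_frequently_mem
    (((hc.tendsto 0).eventually (by simpa using mem_interior_iff_mem_nhds.1 hint)).filter_mono
      nhdsWithin_le_nhds).frequently)
  exact dotProduct_self_eq_zero.1 (le_antisymm h (Finset.sum_nonneg fun i _ => mul_self_nonneg _))

/-- Suppose `q ∉ Ω` and slide a small Euclidean ball from `q` towards `p` until it first touches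
`Ω`, at `y`. The vector from `y` to the center is then an outward normal at a positive boundary
point, hence has non-negative entries. As `p - q` is positive, the center was approaching from
nearer to `y`, so the ball touched `Ω` earlier: a contradiction. No regularity of `∂Ω` is needed. -/
theorem IsMonotoneToric.mem_of_lt (hΩ : IsMonotoneToric Ω) {p q : Fin n → ℝ} (hp : p ∈ Ω)
    (hq : ∀ i, 0 < q i) (hqp : ∀ i, q i < p i) : q ∈ Ω := by
  by_contra hqΩ
  have hcl : IsClosed Ω := hΩ.1.1.isClosed
  have hpos : IsOpen {x : Fin n → ℝ | ∀ i, 0 < x i} := by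
    simp only [ofPred_forall]
    exact isOpen_iInter_of_finite fun i => isOpen_lt continuous_const (continuous_apply i)
  obtain ⟨ρ, hρ, hball⟩ := Metric.isOpen_iff.1 (hcl.isOpen_compl.inter hpos) q ⟨hqΩ, hq⟩
  -- `ρ` is a radius for the sup metric and `r` for the Euclidean one; Euclidean distance at most
  -- `r` bounds each coordinate by `r < ρ`.
  set r := ρ / 2 with hr
  have hr0 : 0 < r := by positivity
  have hrρ : r < ρ := by linarith
  have hqr : ∀ i, r < q i := fun i => by
    have h : (fun i => q i - r) ∈ Metric.ball q ρ := by
      rw [Metric.mem_ball, dist_pi_lt_iff hρ]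
      intro i
      rw [Real.dist_eq, sub_sub_cancel_left, abs_neg, abs_of_pos hr0]
      exact hrρ
    have := (hball h).2 i
    simp only at this
    linarith
  have habs : ∀ c y : Fin n → ℝ, ∑ i, (c i - y i) ^ 2 ≤ r ^ 2 → ∀ i, |c i - y i| ≤ r := by
    intro c y h i
    refine abs_le_of_sq_le_sq ?_ hr0.le
    exact (Finset.single_le_sum (f := fun i => (c i - y i) ^ 2)
      (fun i _ => sq_nonneg _) (Finset.mem_univ i)).trans h
  set γ : ℝ → Fin n → ℝ := fun s i => q i + s * (p i - q i) with hγ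
  have hφ : Continuous fun x : ℝ × (Fin n → ℝ) => ∑ i, (γ x.1 i - x.2 i) ^ 2 := by
    simp only [hγ]; fun_prop
  -- Pairs of a time and a point of `Ω` in the closed ball at that time; minimizing the time gives
  -- the first contact.
  set K : Set (ℝ × (Fin n → ℝ)) := (Icc 0 1 ×ˢ Ω) ∩ {x | ∑ i, (γ x.1 i - x.2 i) ^ 2 ≤ r ^ 2}
  have hK : IsCompact K :=
    (isCompact_Icc.prod hΩ.1.1).inter_right (isClosed_le hφ continuous_const)
  have hKne : K.Nonempty := ⟨(1, p), ⟨⟨by simp, hp⟩, by simp [hγ]; positivity⟩⟩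
  obtain ⟨⟨s, y⟩, ⟨⟨hs, hy⟩, hsy⟩, hmin⟩ := hK.exists_isMinOn hKne continuous_fst.continuousOn
  simp only [mem_ofPred_eq] at hs hy hsy
  have hmin' : ∀ t ∈ Icc (0 : ℝ) 1, ∀ x ∈ Ω, ∑ i, (γ t i - x i) ^ 2 ≤ r ^ 2 → s ≤ t :=
    fun t ht x hx h => hmin (a := (t, x)) ⟨⟨ht, hx⟩, h⟩
  have hs0 : 0 < s := by
    refine lt_of_le_of_ne hs.1 fun h0 => ?_
    have hyb : y ∈ Metric.ball q ρ := by
      rw [Metric.mem_ball, dist_pi_lt_iff hρ]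
      intro i
      have := habs _ _ hsy i
      rw [dist_comm, Real.dist_eq]
      simp only [hγ, ← h0, zero_mul, add_zero] at this
      linarith
    exact (hball hyb).1 hy
  -- no point of `Ω` is closer to the center than the radius
  have hge : ∀ x ∈ Ω, r ^ 2 ≤ ∑ i, (γ s i - x i) ^ 2 := by
    intro x hx
    by_contra! hlt
    have hc : Continuous fun t => ∑ i, (γ t i - x i) ^ 2 := by simp only [hγ]; fun_prop
    have h1 := (hc.tendsto s).eventually (gt_mem_nhds hlt)
    have h2 : ∀ᶠ t in nhdsWithin s (Iio s), t ∈ Ioo 0 s := Ioo_mem_nhdsLT hs0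
    obtain ⟨t, ht1, ht2⟩ := ((h1.filter_mono nhdsWithin_le_nhds).and h2).exists
    exact absurd (hmin' t ⟨ht2.1.le, (ht2.2.trans_le hs.2).le⟩ x hx ht1.le) (not_le.2 ht2.2)
  have hsyeq : ∑ i, (γ s i - y i) ^ 2 = r ^ 2 := le_antisymm hsy (hge y hy)
  have hnormal : IsOutwardNormal Ω y (γ s - y) :=
    isOutwardNormal_of_minimizer fun x hx => hsy.trans (hge x hx)
  have hne : γ s - y ≠ 0 := fun h => by
    have h0 : ∀ i, γ s i - y i = 0 := fun i => congrFun h i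
    simp only [h0] at hsyeq
    have : (0 : ℝ) < r ^ 2 := by positivity
    simp at hsyeq
    linarith
  have hypos : ∀ i, 0 < y i := fun i => by
    have h1 := (abs_le.1 (habs _ _ hsy i)).2
    have h2 : q i ≤ γ s i := by
      have := mul_nonneg hs.1 (sub_pos.2 (hqp i)).le
      simp only [hγ]; linarith
    linarith [hqr i]
  have hv := hΩ.2 y (mem_frontier_of_isOutwardNormal hy hnormal hne) hypos _ hnormal
  obtain ⟨j, hj⟩ : ∃ j, 0 < γ s j - y j := by
    by_contra! h
    exact hne (funext fun i => le_antisymm (h i) (hv i))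
  -- moving the center back along the segment brings it closer to `y`
  have hdpos : 0 < ∑ i, (γ s i - y i) * (p i - q i) :=
    Finset.sum_pos' (fun i _ => mul_nonneg (hv i) (sub_pos.2 (hqp i)).le)
      ⟨j, Finset.mem_univ _, mul_pos hj (sub_pos.2 (hqp j))⟩
  set a := ∑ i, (γ s i - y i) * (p i - q i)
  set b := ∑ i, (p i - q i) ^ 2
  have hb : 0 ≤ b := Finset.sum_nonneg fun i _ => sq_nonneg _
  -- The bound by `s` keeps the earlier time non-negative; `h * (b + 1) ≤ a` makes the quadratic
  -- term `h² b` smaller than the linear gain `2ha`.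
  set h := min s (a / (b + 1))
  have hh0 : 0 < h := lt_min hs0 (by positivity)
  have hhs : h ≤ s := min_le_left _ _
  have hhb : h * (b + 1) ≤ a := by
    rw [← le_div_iff₀ (by positivity)]; exact min_le_right _ _
  have hexp : ∑ i, (γ (s - h) i - y i) ^ 2 = r ^ 2 - 2 * h * a + h ^ 2 * b := by
    rw [← hsyeq, Finset.mul_sum, Finset.mul_sum, ← Finset.sum_sub_distrib,
      ← Finset.sum_add_distrib]
    exact Finset.sum_congr rfl fun i _ => by simp only [hγ]; ring
  have hle : ∑ i, (γ (s - h) i - y i) ^ 2 ≤ r ^ 2 := by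
    rw [hexp]; nlinarith
  have := hmin' (s - h) ⟨by linarith, by linarith [hs.2]⟩ y hy hle
  linarith

theorem IsMonotoneToric.nonneg_of_mem (hΩ : IsMonotoneToric Ω) {p : Fin n → ℝ} (hp : p ∈ Ω) :
    0 ≤ p := by
  obtain ⟨U, -, -, rfl⟩ := hΩ.1.2
  exact closure_minimal inter_subset_right (isClosed_le continuous_const continuous_id) hp

theorem IsMonotoneToric.pos_of_mem_interior (hΩ : IsMonotoneToric Ω) {p : Fin n → ℝ}
    (hp : p ∈ interior Ω) (i : Fin n) : 0 < p i := by
  have hsub : Ω ⊆ univ.pi fun _ : Fin n => Ici (0 : ℝ) :=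
    fun x hx i _ => hΩ.nonneg_of_mem hx i
  have h1 := interior_mono hsub hp
  rw [interior_pi_set finite_univ] at h1
  simpa using h1 i trivial

/-- The whole open box `∏ (0, pᵢ)` lies in `Ω`. -/
theorem IsMonotoneToric.mem_interior_of_lt (hΩ : IsMonotoneToric Ω) {p q : Fin n → ℝ}
    (hp : p ∈ Ω) (hq : ∀ i, 0 < q i) (hqp : ∀ i, q i < p i) : q ∈ interior Ω := by
  refine mem_interior.2 ⟨univ.pi fun i => Ioo 0 (p i), fun x hx => ?_,
    isOpen_set_pi finite_univ fun i _ => isOpen_Ioo, fun i _ => ⟨hq i, hqp i⟩⟩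
  exact hΩ.mem_of_lt hp (fun i => (hx i trivial).1) fun i => (hx i trivial).2

/-- A shrunk copy of a point of `Ω` lies strictly below another point of `Ω`, even if some of its
coordinates vanish. -/
theorem IsMonotoneToric.exists_gt (hΩ : IsMonotoneToric Ω) {p : Fin n → ℝ} (hp : p ∈ Ω)
    {c : ℝ} (hc : c < 1) : ∃ u ∈ Ω, ∀ i, c * p i < u i := by
  obtain ⟨U, hU, -, hUΩ⟩ := hΩ.1.2
  -- approximate `p` by a point of `U` in the orthant
  have hopen : IsOpen {x : Fin n → ℝ | ∀ i, c * p i < x i ∨ p i = 0} := by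
    simp only [ofPred_forall]
    refine isOpen_iInter_of_finite fun i => ?_
    by_cases h : p i = 0
    · simp [h]
    · simp only [h, or_false]
      exact isOpen_lt continuous_const (continuous_apply i)
  have hpmem : p ∈ {x : Fin n → ℝ | ∀ i, c * p i < x i ∨ p i = 0} := fun i => by
    rcases (hΩ.nonneg_of_mem hp i).lt_or_eq with h | h
    · left
      have h' : 0 < p i := h
      nlinarith
    · exact Or.inr h.symm
  obtain ⟨x, hx1, hx2, hx3⟩ := mem_closure_iff.1 (hUΩ ▸ hp : p ∈ closure (U ∩ {p | 0 ≤ p}))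
    _ hopen hpmem
  have hcont : Continuous fun t : ℝ => fun i => x i + t := by fun_prop
  have h1 : ∀ᶠ t in nhds (0 : ℝ), (fun i => x i + t) ∈ U :=
    (hcont.tendsto 0).eventually (by simpa using hU.mem_nhds hx2)
  obtain ⟨t, ht1, ht2⟩ := ((h1.filter_mono nhdsWithin_le_nhds).and
    (self_mem_nhdsWithin : ∀ᶠ t in nhdsWithin (0 : ℝ) (Ioi 0), t ∈ Ioi 0)).exists
  have ht2 : 0 < t := ht2
  refine ⟨fun i => x i + t, hUΩ ▸ subset_closure ⟨ht1, fun i => ?_⟩, fun i => ?_⟩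
  · have : 0 ≤ x i := hx3 i
    simp only [Pi.zero_apply]; linarith
  · have : 0 ≤ x i := hx3 i
    rcases hx1 i with h | h
    · simp only; linarith
    · simp only [h]; linarith

/-- The shrunk copies of `Ω` can be enlarged a bit in all coordinate directions. -/
theorem IsMonotoneToric.exists_margin (hΩ : IsMonotoneToric Ω) {c : ℝ} (hc : c < 1) :
    ∃ δ > 0, ∀ p ∈ Ω, ∀ q : Fin n → ℝ, (∀ i, 0 < q i) → (∀ i, q i ≤ c * p i + δ) → q ∈ interior Ω := by
  -- `G` is an open set containing the compact set `c • Ω`, hence also a closed `δ`-thickening of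
  -- it. In the sup metric, adding `δ` to every coordinate moves a point by at most `δ`.
  set G : Set (Fin n → ℝ) := {x | ∃ u ∈ Ω, ∀ i, x i < u i} with hG
  have hGo : IsOpen G := by
    have : G = ⋃ u ∈ Ω, univ.pi fun i => Iio (u i) := by ext; simp [hG]
    rw [this]
    exact isOpen_biUnion fun u _ => isOpen_set_pi finite_univ fun i _ => isOpen_Iio
  have hsub : (fun p : Fin n → ℝ => c • p) '' Ω ⊆ G := by
    rintro _ ⟨p, hp, rfl⟩
    exact hΩ.exists_gt hp hc
  obtain ⟨δ, hδ, hthick⟩ :=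
    (hΩ.1.1.image (continuous_const_smul c)).exists_cthickening_subset_open hGo hsub
  refine ⟨δ, hδ, fun p hp q hq hqp => ?_⟩
  obtain ⟨u, hu, hlt⟩ : (fun i => c * p i + δ) ∈ G := by
    refine hthick (Metric.mem_cthickening_of_dist_le _ (c • p) _ _ ⟨p, hp, rfl⟩ ?_)
    refine (dist_pi_le_iff hδ.le).2 fun i => ?_
    simp [abs_of_pos hδ]
  exact hΩ.mem_interior_of_lt hu hq fun i => (hqp i).trans_lt (hlt i)

end Geometry

/-! ### Planar symplectic maps and their products -/

section Product

/-- `x ↦ √(p / π) e^{2πiq}` on the universal cover of the cylinder. -/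
noncomputable def polarLift (x : ℝ × ℝ) : ℂ :=
  √(x.2 / Real.pi) • Complex.exp ((2 * Real.pi * x.1 : ℝ) * Complex.I)

/-- `(q, p) ↦ √(p / π) e^{2πiq}` on the cylinder. -/
noncomputable def polarMap (x : UnitAddCircle × ℝ) : ℂ :=
  √(x.2 / Real.pi) • (AddCircle.toCircle x.1 : ℂ)

/-- Symplectic polar coordinates `w ↦ (arg w / 2π, π|w|²)`, with the branch of the argument that is
smooth away from the ray opposite to `c`. -/
noncomputable def angleLift (c w : ℂ) : ℝ × ℝ :=
  ((Complex.log (w / c)).im / (2 * Real.pi) + c.arg / (2 * Real.pi), Real.pi * ‖w‖ ^ 2)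

theorem polarMap_coe (x : ℝ × ℝ) : polarMap ((x.1 : UnitAddCircle), x.2) = polarLift x := by
  simp [polarMap, polarLift, AddCircle.toCircle_apply_mk, Circle.coe_exp]

theorem continuous_polarMap : Continuous polarMap := by
  unfold polarMap
  have := AddCircle.continuous_toCircle (T := 1)
  fun_prop

theorem norm_polarMap (x : UnitAddCircle × ℝ) : ‖polarMap x‖ = √(x.2 / Real.pi) := by
  rw [polarMap, norm_smul, Circle.norm_coe, mul_one, Real.norm_of_nonneg (Real.sqrt_nonneg _)]

theorem pi_mul_norm_polarMap_sq (x : UnitAddCircle × ℝ) (hx : 0 ≤ x.2) :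
    Real.pi * ‖polarMap x‖ ^ 2 = x.2 := by
  rw [norm_polarMap, Real.sq_sqrt (div_nonneg hx Real.pi_pos.le)]
  field_simp

theorem polarMap_injOn : InjOn polarMap {x | 0 < x.2} := by
  rintro ⟨q, p⟩ hx ⟨q', p'⟩ hx' h
  have hp : 0 < p := hx
  have hp' : 0 < p' := hx'
  obtain rfl : p = p' := by
    have h1 := pi_mul_norm_polarMap_sq (q, p) hp.le
    have h2 := pi_mul_norm_polarMap_sq (q', p') hp'.le
    rw [h] at h1
    exact h1.symm.trans h2
  have hr : √(p / Real.pi) ≠ 0 := (Real.sqrt_pos.2 (div_pos hp Real.pi_pos)).ne'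
  have := smul_right_injective ℂ hr h
  exact Prod.ext (AddCircle.injective_toCircle one_ne_zero (Circle.ext this)) rfl

/-- Valid on the branch cut and at `w = 0` too: the exponential forgets the branch, and radius zero
makes the angle irrelevant. -/
theorem polarLift_angleLift {c : ℂ} (hc : c ≠ 0) (w : ℂ) : polarLift (angleLift c w) = w := by
  have hpi := Real.pi_pos
  rw [polarLift, angleLift]
  simp only [mul_div_cancel_left₀ _ hpi.ne', Real.sqrt_sq (norm_nonneg w), Complex.log_im]
  have h1 : 2 * Real.pi * ((w / c).arg / (2 * Real.pi) + c.arg / (2 * Real.pi)) =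
      (w / c).arg + c.arg := by field_simp
  rw [h1, Complex.ofReal_add, add_mul, Complex.exp_add, Complex.real_smul]
  have h2 := Complex.norm_mul_exp_arg_mul_I (w / c)
  have h3 := Complex.norm_mul_exp_arg_mul_I c
  have h4 : (‖c‖ : ℂ) ≠ 0 := by simpa using hc
  rw [norm_div, Complex.ofReal_div] at h2
  calc (‖w‖ : ℂ) * (Complex.exp ((w / c).arg * Complex.I) * Complex.exp (c.arg * Complex.I))
      = (‖w‖ / ‖c‖ * Complex.exp ((w / c).arg * Complex.I)) *
          (‖c‖ * Complex.exp (c.arg * Complex.I)) := by field_simp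
    _ = w := by rw [h2, h3]; field_simp

theorem angleLift_snd_pos (c : ℂ) {w : ℂ} (hw : w ≠ 0) : 0 < (angleLift c w).2 := by
  have := norm_pos_iff.2 hw
  have := Real.pi_pos
  simp only [angleLift]; positivity

theorem polarLift_contDiffOn : ContDiffOn ℝ ∞ polarLift {x | 0 < x.2} := by
  have hsqrt : ContDiffOn ℝ ∞ (fun x : ℝ × ℝ => √(x.2 / Real.pi)) {x | 0 < x.2} := by
    have h : ContDiffOn ℝ ∞ (fun x : ℝ × ℝ => x.2 / Real.pi) {x | 0 < x.2} := by fun_prop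
    refine h.sqrt fun x hx => ?_
    exact (div_pos hx Real.pi_pos).ne'
  have hexp : ContDiff ℝ ∞ fun x : ℝ × ℝ =>
      Complex.exp ((2 * Real.pi * x.1 : ℝ) * Complex.I) := by
    refine Complex.contDiff_exp.comp ?_
    have : ContDiff ℝ ∞ fun x : ℝ × ℝ => Complex.ofRealCLM (2 * Real.pi * x.1) :=
      Complex.ofRealCLM.contDiff.comp (by fun_prop)
    exact this.mul contDiff_const
  exact hsqrt.smul hexp.contDiffOn

theorem fderiv_polarLift {x : ℝ × ℝ} (hx : 0 < x.2) (a : ℝ × ℝ) :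
    fderiv ℝ polarLift x a =
      √(x.2 / Real.pi) • (2 * Real.pi * a.1) • (Complex.I *
        Complex.exp ((2 * Real.pi * x.1 : ℝ) * Complex.I)) +
      (a.2 / (2 * Real.pi * √(x.2 / Real.pi))) •
        Complex.exp ((2 * Real.pi * x.1 : ℝ) * Complex.I) := by
  have hpos := div_pos hx Real.pi_pos
  have h1 : HasFDerivAt (fun x : ℝ × ℝ => √(x.2 / Real.pi))
      ((1 / (2 * √(x.2 / Real.pi))) • (Real.pi⁻¹ • ContinuousLinearMap.snd ℝ ℝ ℝ)) x := by
    have h := (hasFDerivAt_snd (𝕜 := ℝ) (p := x)).mul_const Real.pi⁻¹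
    simp only [← div_eq_mul_inv] at h
    exact h.sqrt hpos.ne'
  have h2 : HasFDerivAt (fun x : ℝ × ℝ => ((2 * Real.pi * x.1 : ℝ) : ℂ) * Complex.I)
      (((2 * Real.pi) • ContinuousLinearMap.fst ℝ ℝ ℝ).smulRight Complex.I) x := by
    have h := (((2 * Real.pi) • ContinuousLinearMap.fst ℝ ℝ ℝ).smulRight Complex.I).hasFDerivAt
      (x := x)
    convert h using 2
    simp
  have h3 := h1.smul h2.cexp
  rw [HasFDerivAt.fderiv (f := polarLift) h3]
  simp
  ring

/-- With `r² = p / π` and `θ = 2πq`, one has `r dr ∧ dθ = dp ∧ dq`. -/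
theorem polarLift_symplectic {x : ℝ × ℝ} (hx : 0 < x.2) (a b : ℝ × ℝ) :
    (fderiv ℝ polarLift x a).re * (fderiv ℝ polarLift x b).im -
      (fderiv ℝ polarLift x a).im * (fderiv ℝ polarLift x b).re = a.2 * b.1 - a.1 * b.2 := by
  have hr : 0 < √(x.2 / Real.pi) := Real.sqrt_pos.2 (div_pos hx Real.pi_pos)
  have hpi := Real.pi_pos
  have hE : (Complex.exp ((2 * Real.pi * x.1 : ℝ) * Complex.I)).re ^ 2 +
      (Complex.exp ((2 * Real.pi * x.1 : ℝ) * Complex.I)).im ^ 2 = 1 := by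
    rw [Complex.exp_ofReal_mul_I_re, Complex.exp_ofReal_mul_I_im, Real.cos_sq_add_sin_sq]
  rw [fderiv_polarLift hx, fderiv_polarLift hx]
  generalize Complex.exp ((2 * Real.pi * x.1 : ℝ) * Complex.I) = E at *
  generalize √(x.2 / Real.pi) = r at *
  simp only [Complex.add_re, Complex.add_im, Complex.smul_re, Complex.smul_im, Complex.I_mul_re,
    Complex.I_mul_im, smul_eq_mul]
  field_simp
  linear_combination (4 * r ^ 2 * Real.pi ^ 2 * (a.2 * b.1 - a.1 * b.2)) * hE

theorem hasFDerivAt_angleLift {c w : ℂ} (hw : w / c ∈ Complex.slitPlane) :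
    HasFDerivAt (angleLift c)
      (((2 * Real.pi)⁻¹ • Complex.imCLM ∘L
        ((w⁻¹ • (1 : ℂ →L[ℂ] ℂ)).restrictScalars ℝ)).prod
        (Real.pi • (2 • innerSL ℝ w))) w := by
  have hw0 : w / c ≠ 0 := Complex.slitPlane_ne_zero hw
  have hw1 : w ≠ 0 := fun h => hw0 (by simp [h])
  have hc : c ≠ 0 := fun h => hw0 (by simp [h])
  refine HasFDerivAt.prodMk ?_ ?_
  -- The logarithmic derivative does not see the constant factor `1 / c`, so the differential is
  -- independent of the branch.
  · have h1 : HasFDerivAt (fun w => Complex.log (w / c)) (w⁻¹ • (1 : ℂ →L[ℂ] ℂ)) w := by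
      have h := ((hasDerivAt_id w).div_const c).clog hw
      simp only [id] at h
      refine h.hasFDerivAt.congr_fderiv ?_
      ext
      simp; field_simp
    have h2 := Complex.imCLM.hasFDerivAt.comp w (h1.restrictScalars ℝ)
    have h3 := (h2.const_smul (2 * Real.pi)⁻¹).add_const (c.arg / (2 * Real.pi))
    convert h3 using 2
    simp; ring
  · have h := (hasFDerivAt_id (𝕜 := ℝ) w).norm_sq.const_smul Real.pi
    exact h

theorem angleLift_contDiffOn (c : ℂ) :
    ContDiffOn ℝ ∞ (angleLift c) {w | w / c ∈ Complex.slitPlane} := by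
  unfold angleLift
  refine ContDiffOn.prodMk ?_ (ContDiff.contDiffOn ?_)
  · refine ContDiffOn.add (ContDiffOn.div_const ?_ _) contDiffOn_const
    have h : ContDiffOn ℝ ∞ (fun w => Complex.log (w / c)) {w | w / c ∈ Complex.slitPlane} := by
      intro w hw
      have h1 : ContDiffAt ℂ ∞ (fun w => Complex.log (w / c)) w :=
        (Complex.contDiffAt_log hw).comp w (contDiff_id.div_const c).contDiffAt
      exact (h1.restrict_scalars ℝ).contDiffWithinAt
    exact Complex.imCLM.contDiff.comp_contDiffOn h
  · exact contDiff_const.mul (contDiff_norm_sq ℝ)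

theorem angleLift_symplectic {c w : ℂ} (hw : w / c ∈ Complex.slitPlane) (a b : ℂ) :
    (fderiv ℝ (angleLift c) w a).2 * (fderiv ℝ (angleLift c) w b).1 -
      (fderiv ℝ (angleLift c) w a).1 * (fderiv ℝ (angleLift c) w b).2 =
      a.re * b.im - a.im * b.re := by
  have hw1 : w ≠ 0 := fun h => Complex.slitPlane_ne_zero hw (by simp [h])
  have hpi := Real.pi_pos
  have hn : Complex.normSq w ≠ 0 := by simpa using hw1
  rw [(hasFDerivAt_angleLift hw).fderiv]
  simp [Complex.inv_re, Complex.inv_im]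
  field_simp
  rw [Complex.normSq_apply]
  ring

variable {n : ℕ}

/-- Products of planar symplectic maps `ℂ → ℝ × ℝ` are symplectic. -/
theorem symplectic_pi_toProd {k : Fin n → ℂ → ℝ × ℝ} {W : Fin n → Set ℂ}
    (hW : ∀ i, IsOpen (W i)) (hk : ∀ i, ContDiffOn ℝ ∞ (k i) (W i))
    (hω : ∀ i, ∀ w ∈ W i, ∀ a b : ℂ,
      (fderiv ℝ (k i) w a).2 * (fderiv ℝ (k i) w b).1 -
        (fderiv ℝ (k i) w a).1 * (fderiv ℝ (k i) w b).2 = a.re * b.im - a.im * b.re) :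
    ContDiffOn ℝ ∞ (fun y : Fin n → ℂ => (fun i => (k i (y i)).1, fun i => (k i (y i)).2))
      (univ.pi W) ∧
    ∀ y ∈ univ.pi W, ∀ a b, omegaCan
      (fderiv ℝ (fun y : Fin n → ℂ => (fun i => (k i (y i)).1, fun i => (k i (y i)).2)) y a)
      (fderiv ℝ (fun y : Fin n → ℂ => (fun i => (k i (y i)).1, fun i => (k i (y i)).2)) y b) =
      omegaStd a b := by
  constructor
  · have h : ∀ i, ContDiffOn ℝ ∞ (fun y : Fin n → ℂ => k i (y i)) (univ.pi W) := fun i =>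
      (hk i).comp (contDiff_apply ℝ ℂ i).contDiffOn fun y hy => hy i trivial
    exact (contDiffOn_pi.2 fun i => contDiff_fst.comp_contDiffOn (h i)).prodMk
      (contDiffOn_pi.2 fun i => contDiff_snd.comp_contDiffOn (h i))
  · intro y hy a b
    have h : ∀ i, HasFDerivAt (fun y : Fin n → ℂ => k i (y i))
        (fderiv ℝ (k i) (y i) ∘L ContinuousLinearMap.proj i) y := fun i =>
      ((((hk i).contDiffAt ((hW i).mem_nhds (hy i trivial))).differentiableAt
        (by simp)).hasFDerivAt).comp y (hasFDerivAt_apply i y)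
    have hd := (hasFDerivAt_pi.2 fun i => (h i).fst).prodMk (hasFDerivAt_pi.2 fun i => (h i).snd)
    rw [hd.fderiv]
    exact Finset.sum_congr rfl fun i _ => hω i _ (hy i trivial) (a i) (b i)

/-- Products of planar symplectic maps `ℝ × ℝ → ℂ` are symplectic. -/
theorem symplectic_pi_ofProd {k : ℝ × ℝ → ℂ} {W : Set (ℝ × ℝ)}
    (hW : IsOpen W) (hk : ContDiffOn ℝ ∞ k W)
    (hω : ∀ w ∈ W, ∀ a b : ℝ × ℝ, (fderiv ℝ k w a).re * (fderiv ℝ k w b).im -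
      (fderiv ℝ k w a).im * (fderiv ℝ k w b).re = a.2 * b.1 - a.1 * b.2) :
    ContDiffOn ℝ ∞ (fun (y : (Fin n → ℝ) × (Fin n → ℝ)) i => k (y.1 i, y.2 i))
      {y | ∀ i, (y.1 i, y.2 i) ∈ W} ∧
    ∀ y : (Fin n → ℝ) × (Fin n → ℝ), (∀ i, (y.1 i, y.2 i) ∈ W) → ∀ a b, omegaStd
      (fderiv ℝ (fun (y : (Fin n → ℝ) × (Fin n → ℝ)) i => k (y.1 i, y.2 i)) y a)
      (fderiv ℝ (fun (y : (Fin n → ℝ) × (Fin n → ℝ)) i => k (y.1 i, y.2 i)) y b) =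
      omegaCan a b := by
  constructor
  · refine contDiffOn_pi.2 fun i => hk.comp (ContDiff.contDiffOn ?_) fun y hy => hy i
    fun_prop
  · intro y hy a b
    let ev : Fin n → (Fin n → ℝ) × (Fin n → ℝ) →L[ℝ] ℝ × ℝ := fun i =>
      (ContinuousLinearMap.proj i ∘L ContinuousLinearMap.fst ℝ _ _).prod
        (ContinuousLinearMap.proj i ∘L ContinuousLinearMap.snd ℝ _ _)
    have h : ∀ i, HasFDerivAt (fun y : (Fin n → ℝ) × (Fin n → ℝ) => k (y.1 i, y.2 i))
        (fderiv ℝ k (y.1 i, y.2 i) ∘L ev i) y := fun i => by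
      have h1 := ((hk.contDiffAt (hW.mem_nhds (hy i))).differentiableAt (by simp)).hasFDerivAt
      exact HasFDerivAt.comp (f := ev i) y h1 (ev i).hasFDerivAt
    rw [(hasFDerivAt_pi.2 h).fderiv]
    exact Finset.sum_congr rfl fun i _ => hω _ (hy i) (a.1 i, a.2 i) (b.1 i, b.2 i)

end Product

/-! ### Symplectic polar coordinates -/

section Polar

variable {n : ℕ}

/-- Symplectic polar coordinates on `ℂⁿ`; a section of `torusPolar`. -/
noncomputable def torusAngle (z : Fin n → ℂ) : CotangentTorus n :=
  torusCover n (fun i => (angleLift 1 (z i)).1, fun i => (angleLift 1 (z i)).2)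

/-- `(q, p) ↦ (√(pᵢ / π) e^{2πiqᵢ})ᵢ`. -/
noncomputable def torusPolar (x : CotangentTorus n) : Fin n → ℂ :=
  fun i => polarMap (x.1 i, x.2 i)

theorem continuous_torusPolar : Continuous (torusPolar (n := n)) :=
  continuous_pi fun i => continuous_polarMap.comp (by fun_prop)

theorem torusPolar_torusCover (x : (Fin n → ℝ) × (Fin n → ℝ)) :
    torusPolar (torusCover n x) = fun i => polarLift (x.1 i, x.2 i) :=
  funext fun i => polarMap_coe (x.1 i, x.2 i)

theorem torusPolar_torusAngle (z : Fin n → ℂ) : torusPolar (torusAngle z) = z := by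
  rw [torusAngle, torusPolar_torusCover]
  exact funext fun i => polarLift_angleLift one_ne_zero (z i)

theorem moment_torusPolar {x : CotangentTorus n} (hx : ∀ i, 0 < x.2 i) :
    moment (torusPolar x) = x.2 :=
  funext fun i => pi_mul_norm_polarMap_sq _ (hx i).le

theorem torusAngle_snd (z : Fin n → ℂ) : (torusAngle z).2 = moment z := rfl

theorem continuous_moment : Continuous (moment (n := n)) := by
  unfold moment; fun_prop

theorem pos_of_moment_pos {z : Fin n → ℂ} {i : Fin n} (h : 0 < moment z i) : z i ≠ 0 := by
  rintro h0
  simp [moment, h0] at h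

theorem torusPolar_injOn : InjOn (torusPolar (n := n)) {x | ∀ i, 0 < x.2 i} := by
  intro x hx y hy h
  have h1 : ∀ i, (x.1 i, x.2 i) = (y.1 i, y.2 i) := fun i =>
    polarMap_injOn (hx i) (hy i) (congrFun h i)
  exact Prod.ext (funext fun i => congrArg Prod.fst (h1 i))
    (funext fun i => congrArg Prod.snd (h1 i))

theorem continuous_torusCover : Continuous (torusCover n) := by
  have : Continuous ((↑) : ℝ → UnitAddCircle) := AddCircle.continuous_mk' 1
  unfold torusCover
  fun_prop

variable {P : Set (Fin n → ℝ)}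

theorem isSymplecticMapOn_torusPolar (hP : ∀ p ∈ P, ∀ i, 0 < p i) :
    IsSymplecticMapOn (torusCover n) omegaCan id omegaStd torusPolar (univ ×ˢ P) := by
  intro x hx
  obtain ⟨h1, h2⟩ := symplectic_pi_ofProd (n := n) (isOpen_lt continuous_const continuous_snd)
    polarLift_contDiffOn fun w hw a b => polarLift_symplectic hw a b
  refine ⟨{y | ∀ i, (y.1 i, y.2 i) ∈ {x : ℝ × ℝ | 0 < x.2}}, ?_, hP _ hx.2, _, h1,
    fun y _ => (torusPolar_torusCover y).symm, h2⟩
  have : {y : (Fin n → ℝ) × (Fin n → ℝ) | ∀ i, (y.1 i, y.2 i) ∈ {x : ℝ × ℝ | 0 < x.2}} =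
      ⋂ i, {y | 0 < y.2 i} := by ext; simp
  rw [this]
  exact isOpen_iInter_of_finite fun i => isOpen_lt continuous_const (by fun_prop)

theorem isOpen_slit (c : ℂ) : IsOpen {w : ℂ | w / c ∈ Complex.slitPlane} :=
  Complex.isOpen_slitPlane.preimage (continuous_id.div_const c)

/-- The lift defining `torusAngle` jumps across the negative real axis, but its class modulo `ℤⁿ`
does not. Near `x` it is represented by the branches `angleLift (x i)`, which are cut opposite to `x
i`; the two lifts agree on the torus because `torusPolar` sends both to the same point and is
injective on positive momenta. -/
theorem isSymplecticMapOn_torusAngle (hP : ∀ p ∈ P, ∀ i, 0 < p i) :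
    IsSymplecticMapOn id omegaStd (torusCover n) omegaCan torusAngle (toricSet P) := by
  intro x hx
  have hx0 : ∀ i, x i ≠ 0 := fun i => pos_of_moment_pos (hP _ hx i)
  obtain ⟨h1, h2⟩ := symplectic_pi_toProd (k := fun i => angleLift (x i))
    (fun i => isOpen_slit (x i)) (fun i => angleLift_contDiffOn (x i))
    fun i w hw a b => angleLift_symplectic hw a b
  refine ⟨_, isOpen_set_pi finite_univ fun i _ => isOpen_slit (x i), fun i _ => ?_, _, h1,
    fun y hy => ?_, h2⟩
  · show x i / x i ∈ Complex.slitPlane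
    rw [div_self (hx0 i)]
    exact Complex.one_mem_slitPlane
  · have hy0 : ∀ i, y i ≠ 0 := fun i h =>
      Complex.slitPlane_ne_zero (hy i trivial : y i / x i ∈ Complex.slitPlane) (by simp [h])
    refine torusPolar_injOn (fun i => angleLift_snd_pos (x i) (hy0 i))
      (fun i => angleLift_snd_pos 1 (hy0 i)) ?_
    rw [id, torusPolar_torusAngle, torusPolar_torusCover]
    exact funext fun i => polarLift_angleLift (hx0 i) (y i)

theorem symplectomorphic_toricSet (hPo : IsOpen P) (hP : ∀ p ∈ P, ∀ i, 0 < p i) :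
    Symplectomorphic (torusCover n) omegaCan id omegaStd (univ ×ˢ P) (toricSet P) := by
  refine ⟨isOpen_univ.prod hPo, hPo.preimage continuous_moment, torusPolar, torusAngle,
    fun x hx => ?_, fun z hz => ⟨trivial, hz⟩, ⟨fun x hx => ?_, fun z _ => torusPolar_torusAngle z⟩,
    isSymplecticMapOn_torusPolar hP, isSymplecticMapOn_torusAngle hP⟩
  · show moment (torusPolar x) ∈ P
    rw [moment_torusPolar (hP _ hx.2)]
    exact hx.2
  · have h := moment_torusPolar (hP _ hx.2)
    refine torusPolar_injOn (fun i => ?_) (hP _ hx.2) (torusPolar_torusAngle _)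
    rw [torusAngle_snd, h]
    exact hP _ hx.2 i

end Polar

/-! ### Continuity of symplectic maps and the polar embedding -/

section Continuity

variable {V V' M M' : Type*} [NormedAddCommGroup V] [NormedSpace ℝ V]
  [NormedAddCommGroup V'] [NormedSpace ℝ V'] [TopologicalSpace M] [TopologicalSpace M']

/-- A symplectic map is continuous, if its domain has a global chart. -/
theorem IsSymplecticMapOn.continuousOn {η : V → V → ℝ} {c' : V' → M'} {η' : V' → V' → ℝ}
    {f : V → M'} {U : Set V} (hf : IsSymplecticMapOn id η c' η' f U) (hc' : Continuous c') :
    ContinuousOn f U := by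
  intro x hx
  obtain ⟨W, hW, hxW, g, hg, hgf, -⟩ := hf x hx
  have h1 : ContinuousAt g x := hg.continuousOn.continuousAt (hW.mem_nhds hxW)
  have h2 : ContinuousAt (c' ∘ g) x := hc'.continuousAt.comp h1
  refine (h2.congr ?_).continuousWithinAt
  filter_upwards [hW.mem_nhds hxW] with y hy using hgf y hy

end Continuity

theorem symplecticallyEmbeds_toricSet {n : ℕ} {P : Set (Fin n → ℝ)} {T : Set (Fin n → ℝ)}
    (hPo : IsOpen P) (hP : ∀ p ∈ P, ∀ i, 0 < p i) (hPT : P ⊆ T) :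
    SymplecticallyEmbeds (torusCover n) omegaCan id omegaStd (univ ×ˢ P) (toricSet T) := by
  have hmaps : MapsTo torusPolar (univ ×ˢ P) (toricSet P) := fun x hx => by
    show moment (torusPolar x) ∈ P
    rw [moment_torusPolar (hP _ hx.2)]
    exact hx.2
  refine ⟨univ ×ˢ P, torusPolar, isOpen_univ.prod hPo, Subset.rfl,
    isSymplecticMapOn_torusPolar hP, ?_, fun x hx => hPT (hmaps hx)⟩
  -- Continuity of the inverse is not visible from its formula, which uses a discontinuous branch;
  -- it follows from the smooth local representatives.
  have hcont : Continuous fun z : toricSet P => torusAngle (z : Fin n → ℂ) :=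
    ((isSymplecticMapOn_torusAngle hP).continuousOn continuous_torusCover).domRestrict
  have hmaps' : ∀ z : toricSet P, torusAngle (z : Fin n → ℂ) ∈ univ ×ˢ P := fun z =>
    ⟨trivial, z.2⟩
  have hemb : Topology.IsEmbedding (hmaps.restrict torusPolar (univ ×ˢ P) (toricSet P)) := by
    refine Function.LeftInverse.isEmbedding (f := fun z : toricSet P =>
      (⟨torusAngle (z : Fin n → ℂ), hmaps' z⟩ : (univ ×ˢ P : Set (CotangentTorus n))))
      (fun x => Subtype.ext ?_) (hcont.subtype_mk _)
      ((continuous_torusPolar.comp continuous_subtype_val).subtype_mk _)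
    refine torusPolar_injOn (fun i => ?_) (hP _ x.2.2) (torusPolar_torusAngle _)
    exact hP _ (hmaps' ⟨_, hmaps x.2⟩).2 i
  exact Topology.IsEmbedding.subtypeVal.comp hemb

/-! ### Pushing a disc off a ray -/

section Stretch

/-- An increasing diffeomorphism of `ℝ` close to the identity, with a large derivative at `0`. -/
noncomputable def stretch (η K y : ℝ) : ℝ := y + η * Real.arctan (K * y)

/-- The inverse of the derivative of `stretch`. -/
noncomputable def squeeze (η K y : ℝ) : ℝ := (1 + (K * y) ^ 2) / (1 + η * K + (K * y) ^ 2)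

/-- An area-preserving map of the plane that stretches in the imaginary direction near the real
axis, and squeezes the real axis. -/
noncomputable def slitMap (η K : ℝ) (w : ℂ) : ℂ :=
  ⟨w.re * squeeze η K w.im + η, stretch η K w.im⟩

variable {η K : ℝ}

theorem hasDerivAt_stretch (hK : 0 < K) (y : ℝ) :
    HasDerivAt (stretch η K) (squeeze η K y)⁻¹ y := by
  have h1 : HasDerivAt (fun y => K * y) K y := by simpa using (hasDerivAt_id y).const_mul K
  have h2 := (hasDerivAt_id y).add ((h1.arctan).const_mul η)
  refine h2.congr_deriv ?_
  have : (0 : ℝ) < 1 + (K * y) ^ 2 := by positivity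
  rw [squeeze]
  field_simp
  ring

theorem squeeze_pos (hη : 0 < η) (hK : 0 < K) (y : ℝ) : 0 < squeeze η K y := by
  unfold squeeze; positivity

theorem squeeze_le_one (hη : 0 < η) (hK : 0 < K) (y : ℝ) : squeeze η K y ≤ 1 := by
  unfold squeeze
  rw [div_le_one (by positivity)]
  have := mul_pos hη hK
  linarith

theorem contDiff_squeeze (hη : 0 < η) (hK : 0 < K) : ContDiff ℝ ∞ (squeeze η K) := by
  unfold squeeze
  refine ContDiff.div (by fun_prop) (by fun_prop) fun y => ?_
  have : (0 : ℝ) < 1 + η * K + (K * y) ^ 2 := by positivity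
  exact this.ne'

theorem contDiff_stretch : ContDiff ℝ ∞ (stretch η K) := by
  unfold stretch
  exact contDiff_id.add (contDiff_const.mul (Real.contDiff_arctan.comp (by fun_prop)))

theorem strictMono_stretch (hη : 0 < η) (hK : 0 < K) : StrictMono (stretch η K) :=
  strictMono_of_deriv_pos fun y => by
    rw [(hasDerivAt_stretch hK y).deriv]
    exact inv_pos.2 (squeeze_pos hη hK y)

theorem abs_stretch_sub_le (hη : 0 < η) (y : ℝ) : |stretch η K y - y| ≤ 2 * η := by
  have h1 := Real.arctan_lt_pi_div_two (K * y)
  have h2 := Real.neg_pi_div_two_lt_arctan (K * y)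
  have h3 := Real.pi_lt_four
  rw [stretch, add_sub_cancel_left, abs_le]
  constructor <;> nlinarith

theorem surjective_stretch (hη : 0 < η) : Function.Surjective (stretch η K) := by
  have h := fun y => abs_le.1 (abs_stretch_sub_le (K := K) hη y)
  refine contDiff_stretch.continuous.surjective ?_ ?_
  · exact Filter.tendsto_atTop_mono (fun y => by simp only [id]; linarith [(h y).1])
      (Filter.tendsto_atTop_add_const_right _ (-(2 * η)) Filter.tendsto_id)
  · exact Filter.tendsto_atBot_mono (fun y => by simp only [id]; linarith [(h y).2])
      (Filter.tendsto_atBot_add_const_right _ (2 * η) Filter.tendsto_id)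

theorem contDiff_slitMap (hη : 0 < η) (hK : 0 < K) : ContDiff ℝ ∞ (slitMap η K) := by
  have h1 : ContDiff ℝ ∞ fun w : ℂ => w.re * squeeze η K w.im + η :=
    (Complex.reCLM.contDiff.mul ((contDiff_squeeze hη hK).comp Complex.imCLM.contDiff)).add
      contDiff_const
  have h2 : ContDiff ℝ ∞ fun w : ℂ => stretch η K w.im :=
    contDiff_stretch.comp Complex.imCLM.contDiff
  exact Complex.equivRealProdCLM.symm.contDiff.comp (h1.prodMk h2)

/-- The map is `(x, y) ↦ (x / h'(y) + η, h(y))` with `h = stretch η K`, so its Jacobian matrix is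
triangular with determinant `h'(y) / h'(y) = 1`. -/
theorem slitMap_symplectic (hη : 0 < η) (hK : 0 < K) (w a b : ℂ) :
    (fderiv ℝ (slitMap η K) w a).re * (fderiv ℝ (slitMap η K) w b).im -
      (fderiv ℝ (slitMap η K) w a).im * (fderiv ℝ (slitMap η K) w b).re =
      a.re * b.im - a.im * b.re := by
  have hd := ((contDiff_slitMap hη hK).differentiable (by simp) w).hasFDerivAt
  have hre := Complex.reCLM.hasFDerivAt.comp w hd
  have him := Complex.imCLM.hasFDerivAt.comp w hd
  have hs := ((contDiff_squeeze hη hK).differentiable (by simp) w.im).hasDerivAt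
  have hre' := ((Complex.reCLM.hasFDerivAt (x := w)).mul
    (hs.comp_hasFDerivAt w Complex.imCLM.hasFDerivAt)).add_const η
  have him' := (hasDerivAt_stretch (η := η) hK w.im).comp_hasFDerivAt w Complex.imCLM.hasFDerivAt
  have hR := fun a => DFunLike.congr_fun (hre.unique hre') a
  have hI := fun a => DFunLike.congr_fun (him.unique him') a
  simp at hR hI
  have hpos := squeeze_pos hη hK w.im
  rw [hR, hR, hI, hI]
  field_simp
  ring

theorem isEmbedding_slitMap (hη : 0 < η) (hK : 0 < K) :
    Topology.IsEmbedding (slitMap η K) := by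
  set e := ((strictMono_stretch hη hK).orderIsoOfSurjective _ (surjective_stretch hη)).toHomeomorph
  have he : ∀ y, e.symm (stretch η K y) = y := fun y => e.symm_apply_apply y
  have hcs := (contDiff_squeeze hη hK).continuous
  have hc : Continuous fun w : ℂ =>
      Complex.equivRealProdCLM.symm ((w.re - η) / squeeze η K (e.symm w.im), e.symm w.im) := by
    refine Complex.equivRealProdCLM.symm.continuous.comp (Continuous.prodMk ?_ ?_)
    · refine Continuous.div (by fun_prop) (by fun_prop) fun w => (squeeze_pos hη hK _).ne'
    · fun_prop
  refine Function.LeftInverse.isEmbedding (fun w => ?_) hc (contDiff_slitMap hη hK).continuous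
  have := (squeeze_pos hη hK w.im).ne'
  apply Complex.ext
  · simp [slitMap, he, this]
  · simp [slitMap, he]

/-- Since `stretch` vanishes only at `0`, only the real axis can meet the ray. There the factor `1 /
(1 + ηK)` squeezes `(-R, R)` into an interval of half-length less than `η`, and the translation by
`η` makes it positive. -/
theorem slitMap_mem_slitPlane (hη : 0 < η) (hK : 0 < K) {R : ℝ} (hR : R ≤ η ^ 2 * K) {w : ℂ}
    (hw : ‖w‖ < R) : slitMap η K w ∈ Complex.slitPlane := by
  rw [Complex.mem_slitPlane_iff]
  by_cases h : w.im = 0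
  · left
    have h1 := (abs_le.1 (Complex.abs_re_le_norm w)).1
    have h2 : squeeze η K 0 = 1 / (1 + η * K) := by simp [squeeze]
    simp only [slitMap, h, h2]
    have h3 : 0 < 1 + η * K := by positivity
    have h4 : w.re * (1 / (1 + η * K)) + η = (w.re + η * (1 + η * K)) / (1 + η * K) := by
      field_simp
    rw [h4]
    refine div_pos ?_ h3
    nlinarith
  · right
    have h0 : stretch η K 0 = 0 := by simp [stretch]
    simp only [slitMap]
    rw [← h0]
    exact (strictMono_stretch hη hK).injective.ne h

/-- The absolute values of the coordinates grow by at most `η` and `2η`, uniformly in `K`. Hence `η`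
can be fixed first for a small error, and `K` then taken large to clear the ray. -/
theorem norm_slitMap_sq_le (hη : 0 < η) (hK : 0 < K) {R : ℝ} {w : ℂ} (hw : ‖w‖ < R) :
    ‖slitMap η K w‖ ^ 2 ≤ ‖w‖ ^ 2 + (6 * R * η + 5 * η ^ 2) := by
  rw [← Complex.normSq_eq_norm_sq, ← Complex.normSq_eq_norm_sq, Complex.normSq_apply,
    Complex.normSq_apply]
  have h1 : |(slitMap η K w).re| ≤ |w.re| + η := by
    refine (abs_add_le _ _).trans ?_
    rw [abs_mul, abs_of_pos hη, abs_of_pos (squeeze_pos hη hK w.im)]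
    have := mul_le_mul_of_nonneg_left (squeeze_le_one hη hK w.im) (abs_nonneg w.re)
    linarith
  have h2 : |(slitMap η K w).im| ≤ |w.im| + 2 * η := by
    have := abs_le.1 (abs_stretch_sub_le (K := K) hη w.im)
    have h := abs_sub_abs_le_abs_sub (stretch η K w.im) w.im
    have h' := abs_stretch_sub_le (K := K) hη w.im
    simp only [slitMap]
    linarith
  have h3 := (Complex.abs_re_le_norm w).trans hw.le
  have h4 := (Complex.abs_im_le_norm w).trans hw.le
  have h5 := mul_self_le_mul_self (abs_nonneg _) h1
  have h6 := mul_self_le_mul_self (abs_nonneg _) h2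
  rw [abs_mul_abs_self] at h5 h6
  have h7 := abs_mul_abs_self w.re
  have h8 := abs_mul_abs_self w.im
  nlinarith

end Stretch

/-! ### Embedding polydiscs and shrunken toric domains into the cotangent bundle -/

/-- A polydisc embeds symplectically into `T^*𝕋ⁿ` such that the momenta are positive and arbitrarily
close to being bounded by the moments. -/
theorem exists_polydisc_embedding (n : ℕ) {R δ : ℝ} (hR : 0 < R) (hδ : 0 < δ) :
    ∃ f : (Fin n → ℂ) → CotangentTorus n,
      IsSymplecticMapOn id omegaStd (torusCover n) omegaCan f {z | ∀ i, ‖z i‖ < R} ∧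
      Topology.IsEmbedding (fun z : {z : Fin n → ℂ | ∀ i, ‖z i‖ < R} => f z) ∧
      ∀ z : Fin n → ℂ, (∀ i, ‖z i‖ < R) → ∀ i, 0 < (f z).2 i ∧ (f z).2 i ≤ moment z i + δ := by
  have hpi := Real.pi_pos
  obtain ⟨η, hη, hηδ⟩ : ∃ η : ℝ, 0 < η ∧ Real.pi * (6 * R * η + 5 * η ^ 2) ≤ δ := by
    -- For `η ≤ 1` the square `η²` is at most `η`, so a bound linear in `η` suffices.
    refine ⟨min 1 (δ / (Real.pi * (6 * R + 5))), lt_min one_pos (by positivity), ?_⟩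
    set η := min 1 (δ / (Real.pi * (6 * R + 5)))
    have h0 : 0 < η := lt_min one_pos (by positivity)
    have h1 : η ≤ 1 := min_le_left _ _
    have h2 : η * (Real.pi * (6 * R + 5)) ≤ δ := by
      rw [← le_div_iff₀ (by positivity)]; exact min_le_right _ _
    have h3 : η ^ 2 ≤ η := by nlinarith
    have h4 : Real.pi * (6 * R * η + 5 * η ^ 2) ≤ Real.pi * (6 * R * η + 5 * η) := by gcongr
    linarith
  obtain ⟨K, hK, hRK⟩ : ∃ K : ℝ, 0 < K ∧ R ≤ η ^ 2 * K :=
    ⟨R / η ^ 2, by positivity, (mul_div_cancel₀ R (by positivity)).ge⟩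
  set τ := slitMap η K
  set W : Set ℂ := {w | ‖w‖ < R}
  have hWo : IsOpen W := isOpen_lt continuous_norm continuous_const
  have hτW : MapsTo τ W {w | w / 1 ∈ Complex.slitPlane} := fun w hw => by
    simpa using slitMap_mem_slitPlane hη hK hRK hw
  have hsmooth : ContDiffOn ℝ ∞ (angleLift 1 ∘ τ) W :=
    (angleLift_contDiffOn 1).comp (contDiff_slitMap hη hK).contDiffOn hτW
  have hUo : IsOpen (univ.pi fun _ : Fin n => W) := isOpen_set_pi finite_univ fun _ _ => hWo
  obtain ⟨h1, h2⟩ := symplectic_pi_toProd (n := n) (k := fun _ => angleLift 1 ∘ τ)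
    (W := fun _ => W) (fun _ => hWo) (fun _ => hsmooth) (by
      intro _ w hw a b
      have h1 := ((angleLift_contDiffOn 1).contDiffAt
        ((isOpen_slit 1).mem_nhds (hτW hw))).differentiableAt (by simp)
      have h2 := (contDiff_slitMap hη hK).differentiable (by simp) w
      simp only [fderiv_comp w h1 h2, ContinuousLinearMap.comp_apply]
      rw [angleLift_symplectic (hτW hw), slitMap_symplectic hη hK])
  have hsymp : IsSymplecticMapOn id omegaStd (torusCover n) omegaCan
      (fun z => torusAngle fun i => τ (z i)) {z | ∀ i, ‖z i‖ < R} := fun x hx =>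
    ⟨_, hUo, fun i _ => hx i, _, h1, fun y _ => rfl, h2⟩
  refine ⟨_, hsymp, ?_, fun z hz i => ⟨?_, ?_⟩⟩
  -- Composing with the continuous map `torusPolar` undoes the polar coordinates and leaves the
  -- product of the planar embeddings `τ`.
  · refine Topology.IsEmbedding.of_comp (g := torusPolar)
      (hsymp.continuousOn continuous_torusCover).domRestrict continuous_torusPolar ?_
    have h : Topology.IsEmbedding fun (z : Fin n → ℂ) i => τ (z i) :=
      Topology.IsEmbedding.piMap fun _ => isEmbedding_slitMap hη hK
    convert h.comp Topology.IsEmbedding.subtypeVal using 1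
    exact funext fun z => torusPolar_torusAngle _
  · refine angleLift_snd_pos 1 (Complex.slitPlane_ne_zero ?_)
    exact slitMap_mem_slitPlane hη hK hRK (hz i)
  · have h3 := norm_slitMap_sq_le hη hK (hz i)
    have h4 := mul_le_mul_of_nonneg_left h3 hpi.le
    rw [torusAngle_snd]
    simp only [moment]
    linarith

theorem IsMonotoneToric.symplecticallyEmbeds_smul {n : ℕ} {Ω : Set (Fin n → ℝ)}
    (hΩ : IsMonotoneToric Ω) {ε : ℝ} (hε0 : 0 < ε) (hε1 : ε < 1) :
    SymplecticallyEmbeds id omegaStd (torusCover n) omegaCan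
      ((1 - ε) • toricSet Ω) (univ ×ˢ interior Ω) := by
  have hpi := Real.pi_pos
  -- The moment map is quadratic: scaling `z` by `1 - ε` scales the moments by `(1 - ε)²`.
  have hc : (1 - ε) ^ 2 < 1 := by nlinarith
  obtain ⟨δ, hδ, hmargin⟩ := hΩ.exists_margin hc
  obtain ⟨B, hB⟩ := hΩ.1.1.isBounded.exists_norm_le
  -- A crude radius: `π|wᵢ|² ≤ |B|` excludes `|wᵢ| ≥ |B| + 1`, as then `|wᵢ|² ≥ |wᵢ|`.
  set R := |B| + 1
  have hR : 0 < R := by positivity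
  obtain ⟨f, hf, hemb, hbound⟩ := exists_polydisc_embedding n hR hδ
  have hsub : (1 - ε) • toricSet Ω ⊆ {z | ∀ i, ‖z i‖ < R} := by
    rintro _ ⟨w, hw, rfl⟩ i
    have h1 : Real.pi * ‖w i‖ ^ 2 ≤ |B| :=
      ((le_abs_self _).trans ((norm_le_pi_norm (moment w) i).trans (hB _ hw))).trans
        (le_abs_self B)
    have h2 : ‖w i‖ < R := by
      have h3 := Real.pi_gt_three
      have h4 := norm_nonneg (w i)
      by_contra! h5
      have h6 : 1 ≤ ‖w i‖ := le_trans (by simp [R]) h5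
      have h7 : |B| + 1 ≤ ‖w i‖ := h5
      nlinarith [abs_nonneg B]
    simp only [Pi.smul_apply, norm_smul, Real.norm_eq_abs]
    rw [abs_of_pos (by linarith)]
    nlinarith [norm_nonneg (w i)]
  have hopen : IsOpen {z : Fin n → ℂ | ∀ i, ‖z i‖ < R} := by
    simp only [ofPred_forall]
    exact isOpen_iInter_of_finite fun i => isOpen_lt (by fun_prop) continuous_const
  refine ⟨_, f, hopen, hsub, hf, hemb, fun z hz => ⟨trivial, ?_⟩⟩
  have hbz := hbound z (hsub hz)
  obtain ⟨w, hw, rfl⟩ := hz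
  refine hmargin (moment w) hw _ (fun i => (hbz i).1) fun i => (hbz i).2.trans_eq ?_
  simp only [moment, Pi.smul_apply, norm_smul, Real.norm_eq_abs, mul_pow, sq_abs]
  ring

end ToricDomain

theorem proposition3p7 (n : ℕ) (Ω : Set (Fin n → ℝ)) (hΩ : ToricDomain.IsMonotoneToric Ω) :
    (∀ ε : ℝ, 0 < ε → ε < 1 →
      ToricDomain.SymplecticallyEmbeds
          id ToricDomain.omegaStd (ToricDomain.torusCover n) ToricDomain.omegaCan
          ((1 - ε) • ToricDomain.toricSet Ω) (univ ×ˢ interior Ω) ∧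
        ToricDomain.SymplecticallyEmbeds
          (ToricDomain.torusCover n) ToricDomain.omegaCan id ToricDomain.omegaStd
          (univ ×ˢ interior Ω) (ToricDomain.toricSet Ω)) ∧
    ToricDomain.Symplectomorphic
      (ToricDomain.torusCover n) ToricDomain.omegaCan id ToricDomain.omegaStd
      (univ ×ˢ interior Ω) (ToricDomain.toricSet (interior Ω)) := by
  have hpos : ∀ p ∈ interior Ω, ∀ i, 0 < p i := fun p hp => hΩ.pos_of_mem_interior hp
  exact ⟨fun ε hε0 hε1 => ⟨hΩ.symplecticallyEmbeds_smul hε0 hε1,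
    ToricDomain.symplecticallyEmbeds_toricSet isOpen_interior hpos interior_subset⟩,
    ToricDomain.symplectomorphic_toricSet isOpen_interior hpos⟩
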